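/- Let $A$ be an $n\times n$ complex matrix with operator (Euclidean) norm $\|A\|\le 1$ and with $n$ distinct eigenvalues, $\sigma(A)=\{z_1,\dots,z_n\}$, all lying in the open unit disk $\mathbb{D}$. Let $$\rho(z,w)=\left|\frac{z-w}{1-\overline{w}z}\right|,\qquad \delta_A=\min_{1\le j\le n}\ \prod_{k\ne j}\rho(z_j,z_k)$$ be the pseudohyperbolic distance and the separation constant of the eigenvalues (an empty product is $1$), and suppose that $\delta_A\ge 2\sqrt2/3$. Then for every bounded analytic function $f$ on $\mathbb{D}$, $$\|f(A)\|\le 2\max_{1\le j\le n}|f(z_j)|,$$ where $f(A)=X f(\Lambda)X^{-1}$ for any factorization $A=X\Lambda X^{-1}$ with $\Lambda$ diagonal, $f$ being applied to the diagonal entries of $\Lambda$. -/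

import Mathlib

open scoped Matrix.Norms.L2Operator

/-- The pseudohyperbolic distance `ρ(z, w) = |(z - w) / (1 - conj w * z)|` on the unit disk. -/
noncomputable def pseudohyperbolicDist (z w : ℂ) : ℝ :=
  ‖(z - w) / (1 - (starRingEnd ℂ) w * z)‖

/-- The separation constant `δ = inf_j ∏_{k ≠ j} ρ(z_j, z_k)` of a finite family of points. -/
noncomputable def separationConstant {ι : Type*} [Fintype ι] [DecidableEq ι] (z : ι → ℂ) : ℝ :=
  ⨅ j, ∏ k ∈ Finset.univ.erase j, pseudohyperbolicDist (z j) (z k)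

/-- `f` is a bounded analytic function on the open unit disk (values off the disk are irrelevant). -/
def MemHInfty (f : ℂ → ℂ) : Prop :=
  DifferentiableOn ℂ f (Metric.ball 0 1) ∧ ∃ C : ℝ, ∀ z ∈ Metric.ball (0 : ℂ) 1, ‖f z‖ ≤ C

/-- `A = X Λ X⁻¹` with `X` invertible and `Λ = diag(d)`. -/
def IsDiagonalization {n : ℕ} (A X : Matrix (Fin n) (Fin n) ℂ) (d : Fin n → ℂ) : Prop :=
  IsUnit X ∧ A = X * Matrix.diagonal d * X⁻¹

open Classical in
/-- `f(A) = X f(Λ) X⁻¹` for a diagonalizable matrix `A = X Λ X⁻¹`; the value does not depend on the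
diagonalization (`matrixFun_eq`). The value `0` at a matrix that is not diagonalizable is never
used: a matrix with distinct eigenvalues is diagonalizable (`exists_isDiagonalization`). -/
noncomputable def matrixFun {n : ℕ} (f : ℂ → ℂ) (A : Matrix (Fin n) (Fin n) ℂ) :
    Matrix (Fin n) (Fin n) ℂ :=
  if h : ∃ p : Matrix (Fin n) (Fin n) ℂ × (Fin n → ℂ), IsDiagonalization A p.1 p.2 then
    h.choose.1 * Matrix.diagonal (f ∘ h.choose.2) * (h.choose.1)⁻¹
  else 0

theorem IsDiagonalization.fun_eq {n : ℕ} {A X Y : Matrix (Fin n) (Fin n) ℂ} {d e : Fin n → ℂ}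
    (hX : IsDiagonalization A X d) (hY : IsDiagonalization A Y e) (f : ℂ → ℂ) :
    X * Matrix.diagonal (f ∘ d) * X⁻¹ = Y * Matrix.diagonal (f ∘ e) * Y⁻¹ := by
  obtain ⟨hXu, hA⟩ := hX
  obtain ⟨hYu, hA'⟩ := hY
  have hXd := (Matrix.isUnit_iff_isUnit_det X).1 hXu
  have hYd := (Matrix.isUnit_iff_isUnit_det Y).1 hYu
  have h1 : A * X = X * Matrix.diagonal d := by
    rw [hA, Matrix.mul_assoc, Matrix.nonsing_inv_mul X hXd, Matrix.mul_one]
  have h2 : Y⁻¹ * A = Matrix.diagonal e * Y⁻¹ := by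
    rw [hA', ← Matrix.mul_assoc, ← Matrix.mul_assoc, Matrix.nonsing_inv_mul Y hYd, Matrix.one_mul]
  have h3 : (Y⁻¹ * X) * Matrix.diagonal d = Matrix.diagonal e * (Y⁻¹ * X) := by
    rw [Matrix.mul_assoc, ← h1, ← Matrix.mul_assoc, h2, Matrix.mul_assoc]
  have h4 : (Y⁻¹ * X) * Matrix.diagonal (f ∘ d) = Matrix.diagonal (f ∘ e) * (Y⁻¹ * X) := by
    ext i j
    have h5 := congrFun (congrFun h3 i) j
    rw [Matrix.mul_diagonal, Matrix.diagonal_mul] at h5 ⊢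
    by_cases h6 : (Y⁻¹ * X) i j = 0
    · simp [h6]
    · have h7 : d j = e i := mul_left_cancel₀ h6 (by rw [h5, mul_comm])
      simp [h7, mul_comm]
  calc X * Matrix.diagonal (f ∘ d) * X⁻¹
      = Y * ((Y⁻¹ * X) * Matrix.diagonal (f ∘ d)) * X⁻¹ := by
        rw [← Matrix.mul_assoc, ← Matrix.mul_assoc, Matrix.mul_nonsing_inv Y hYd, Matrix.one_mul]
    _ = Y * Matrix.diagonal (f ∘ e) * Y⁻¹ * (X * X⁻¹) := by
        rw [h4]; simp only [Matrix.mul_assoc]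
    _ = Y * Matrix.diagonal (f ∘ e) * Y⁻¹ := by
        rw [Matrix.mul_nonsing_inv X hXd, Matrix.mul_one]

theorem matrixFun_eq {n : ℕ} {A X : Matrix (Fin n) (Fin n) ℂ} {d : Fin n → ℂ}
    (hX : IsDiagonalization A X d) (f : ℂ → ℂ) :
    matrixFun f A = X * Matrix.diagonal (f ∘ d) * X⁻¹ := by
  have h : ∃ p : Matrix (Fin n) (Fin n) ℂ × (Fin n → ℂ), IsDiagonalization A p.1 p.2 :=
    ⟨(X, d), hX⟩
  rw [matrixFun, dif_pos h]
  exact h.choose_spec.fun_eq hX f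

theorem exists_isDiagonalization {n : ℕ} {A : Matrix (Fin n) (Fin n) ℂ} {z : Fin n → ℂ}
    (hz : Function.Injective z) (hA : spectrum ℂ A = Set.range z) :
    ∃ X : Matrix (Fin n) (Fin n) ℂ, IsDiagonalization A X z := by
  have h1 : ∀ j, ∃ v, Module.End.HasEigenvector (Matrix.toLin' A) (z j) v := by
    intro j
    have h2 : z j ∈ spectrum ℂ (Matrix.toLin' A) := by
      rw [Matrix.spectrum_toLin', hA]; exact ⟨j, rfl⟩
    exact (Module.End.hasEigenvalue_iff_mem_spectrum.2 h2).exists_hasEigenvector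
  choose v hv using h1
  have hli : LinearIndependent ℂ v :=
    Module.End.eigenvectors_linearIndependent' (Matrix.toLin' A) z hz v hv
  have hu : IsUnit (Matrix.of v).transpose :=
    Matrix.linearIndependent_cols_iff_isUnit.1 hli
  refine ⟨(Matrix.of v).transpose, hu, ?_⟩
  have hd := (Matrix.isUnit_iff_isUnit_det _).1 hu
  have h3 : A * (Matrix.of v).transpose = (Matrix.of v).transpose * Matrix.diagonal z := by
    ext i j
    have h4 := congrFun (hv j).apply_eq_smul i
    rw [Matrix.toLin'_apply] at h4
    rw [Matrix.mul_diagonal]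
    simpa [Matrix.mul_apply, Matrix.mulVec, dotProduct, mul_comm] using h4
  rw [← h3, Matrix.mul_assoc, Matrix.mul_nonsing_inv _ hd, Matrix.mul_one]

/-! Put η = √2/2, so that 2η/(1+η²) = 2√2/3 and η² = 1/2. The separation hypothesis makes every
target `u` with `‖u j‖ < η²` the vector of values at the points `z` of a Blaschke product with as
many zeros as there are points (`exists_blaschkeValues_eq`). For s > 2 max |f(z_j)| the targets
f(z_j)/s qualify, so f(A) = s B(A). Each Blaschke factor of a contraction is a contraction, hence
‖B(A)‖ ≤ 1 and ‖f(A)‖ ≤ s.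

Interpolation is a continuity argument in the zeros, which start at `z` and stay within
pseudohyperbolic distance η of it. There, separation survives with constant η
(`le_prod_pseudohyperbolicDist`), so the zeros stay distinct and cannot reach the boundary while all
values are below η². The map from zeros to values is locally open because its real derivative is
injective (`velocity_eq_zero`, a maximum principle argument). -/

open Finset

/-! ### Pseudohyperbolic geometry and stability of separation -/

/-- The Blaschke factor `(z - a) / (1 - conj a * z)` with zero `a`. -/
noncomputable def blaschkeFactor (a z : ℂ) : ℂ :=
  (z - a) / (1 - (starRingEnd ℂ) a * z)

theorem one_sub_conj_mul_ne_zero {z w : ℂ} (hz : ‖z‖ ≤ 1) (hw : ‖w‖ < 1) :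
    1 - (starRingEnd ℂ) w * z ≠ 0 := by
  intro h
  have h1 : ‖(starRingEnd ℂ) w * z‖ = 1 := by rw [← sub_eq_zero.1 h, norm_one]
  rw [norm_mul, RCLike.norm_conj] at h1
  nlinarith [norm_nonneg z, norm_nonneg w]

theorem norm_one_sub_conj_mul_sq (z w : ℂ) :
    ‖1 - (starRingEnd ℂ) w * z‖ ^ 2 = ‖z - w‖ ^ 2 + (1 - ‖z‖ ^ 2) * (1 - ‖w‖ ^ 2) := by
  simp only [Complex.sq_norm, Complex.normSq_apply, Complex.sub_re, Complex.sub_im, Complex.mul_re,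
    Complex.mul_im, Complex.conj_re, Complex.conj_im, Complex.one_re, Complex.one_im]
  ring

theorem pseudohyperbolicDist_nonneg (z w : ℂ) : 0 ≤ pseudohyperbolicDist z w := norm_nonneg _

theorem pseudohyperbolicDist_comm (z w : ℂ) :
    pseudohyperbolicDist z w = pseudohyperbolicDist w z := by
  rw [pseudohyperbolicDist, pseudohyperbolicDist, norm_div, norm_div, norm_sub_rev,
    ← RCLike.norm_conj (1 - _)]
  simp [mul_comm]

theorem pseudohyperbolicDist_lt_one {z w : ℂ} (hz : ‖z‖ < 1) (hw : ‖w‖ < 1) :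
    pseudohyperbolicDist z w < 1 := by
  have h0 : 0 < ‖1 - (starRingEnd ℂ) w * z‖ :=
    norm_pos_iff.2 (one_sub_conj_mul_ne_zero hz.le hw)
  rw [pseudohyperbolicDist, norm_div, div_lt_one h0]
  refine lt_of_pow_lt_pow_left₀ 2 h0.le ?_
  rw [norm_one_sub_conj_mul_sq]
  have : 0 < (1 - ‖z‖ ^ 2) * (1 - ‖w‖ ^ 2) :=
    mul_pos (by nlinarith [norm_nonneg z]) (by nlinarith [norm_nonneg w])
  linarith

theorem div_le_pseudohyperbolicDist {a b : ℂ} {η : ℝ} (ha : ‖a‖ < 1) (hb : ‖b‖ ≤ η) (hη : η < 1) :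
    (‖a‖ - η) / (1 - η * ‖a‖) ≤ pseudohyperbolicDist a b := by
  have ha0 := norm_nonneg a
  have hb0 := norm_nonneg b
  rcases le_total ‖a‖ η with h | h
  · exact (div_nonpos_of_nonpos_of_nonneg (by linarith) (by nlinarith)).trans
      (pseudohyperbolicDist_nonneg a b)
  have h0 : 0 < ‖1 - (starRingEnd ℂ) b * a‖ :=
    norm_pos_iff.2 (one_sub_conj_mul_ne_zero ha.le (by linarith))
  have h1 : 0 < 1 - ‖b‖ * ‖a‖ := by nlinarith
  have h2 : 0 < 1 - η * ‖a‖ := by nlinarith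
  calc (‖a‖ - η) / (1 - η * ‖a‖) ≤ (‖a‖ - ‖b‖) / (1 - ‖b‖ * ‖a‖) := by
        rw [div_le_div_iff₀ h2 h1]
        nlinarith [mul_nonneg (sub_nonneg.2 hb) (show 0 ≤ 1 - ‖a‖ ^ 2 by nlinarith)]
    _ ≤ pseudohyperbolicDist a b := by
        rw [pseudohyperbolicDist, norm_div, div_le_div_iff₀ h1 h0]
        refine le_of_sq_le_sq ?_ (by positivity)
        rw [mul_pow, mul_pow, norm_one_sub_conj_mul_sq]
        have h3 : (‖a‖ - ‖b‖) ^ 2 ≤ ‖a - b‖ ^ 2 :=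
          pow_le_pow_left₀ (by linarith) (norm_sub_norm_le a b) 2
        have h4 : 0 ≤ (1 - ‖a‖ ^ 2) * (1 - ‖b‖ ^ 2) :=
          mul_nonneg (by nlinarith) (by nlinarith)
        nlinarith [mul_le_mul_of_nonneg_right h3 h4]

theorem pseudohyperbolicDist_blaschkeFactor {z w a : ℂ} (hz : ‖z‖ < 1) (hw : ‖w‖ < 1)
    (ha : ‖a‖ < 1) :
    pseudohyperbolicDist (blaschkeFactor a z) (blaschkeFactor a w) = pseudohyperbolicDist z w := by
  have h1 := one_sub_conj_mul_ne_zero hz.le ha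
  have h2 := one_sub_conj_mul_ne_zero hw.le ha
  have h3 := one_sub_conj_mul_ne_zero ha.le hw
  have h4 := one_sub_conj_mul_ne_zero hz.le hw
  have h5 := one_sub_conj_mul_ne_zero ha.le ha
  have e1 : blaschkeFactor a z - blaschkeFactor a w = (z - w) * (1 - (starRingEnd ℂ) a * a) /
      ((1 - (starRingEnd ℂ) a * z) * (1 - (starRingEnd ℂ) a * w)) := by
    rw [blaschkeFactor, blaschkeFactor, div_sub_div _ _ h1 h2]
    congr 1; ring
  have e2 : 1 - (starRingEnd ℂ) (blaschkeFactor a w) * blaschkeFactor a z =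
      (1 - (starRingEnd ℂ) w * z) * (1 - (starRingEnd ℂ) a * a) /
      ((1 - (starRingEnd ℂ) w * a) * (1 - (starRingEnd ℂ) a * z)) := by
    have h6 : 1 - a * (starRingEnd ℂ) w ≠ 0 := by rwa [mul_comm]
    simp only [blaschkeFactor, map_div₀, map_sub, map_mul, map_one, Complex.conj_conj]
    field_simp
    ring
  have e3 : ‖1 - (starRingEnd ℂ) w * a‖ = ‖1 - (starRingEnd ℂ) a * w‖ := by
    rw [← RCLike.norm_conj (1 - _)]; simp [mul_comm]
  rw [pseudohyperbolicDist, pseudohyperbolicDist, e1, e2]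
  have n1 := norm_ne_zero_iff.2 h1
  have n2 := norm_ne_zero_iff.2 h2
  have n4 := norm_ne_zero_iff.2 h4
  have n5 := norm_ne_zero_iff.2 h5
  simp only [norm_div, norm_mul, e3]
  generalize ‖1 - (starRingEnd ℂ) a * z‖ = x at *
  generalize ‖1 - (starRingEnd ℂ) a * w‖ = y at *
  generalize ‖1 - (starRingEnd ℂ) w * z‖ = t at *
  generalize ‖1 - (starRingEnd ℂ) a * a‖ = u at *
  field_simp

/-- The strong triangle inequality: the disk automorphism `blaschkeFactor a` moves `a` to the
origin, where distances to `a` become absolute values. -/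
theorem div_le_pseudohyperbolicDist_of_le {z w a : ℂ} {η : ℝ} (hz : ‖z‖ < 1) (hw : ‖w‖ < 1)
    (ha : ‖a‖ < 1) (hη : η < 1) (h : pseudohyperbolicDist w a ≤ η) :
    (pseudohyperbolicDist z a - η) / (1 - η * pseudohyperbolicDist z a) ≤
      pseudohyperbolicDist z w := by
  rw [← pseudohyperbolicDist_blaschkeFactor hz hw ha]
  exact div_le_pseudohyperbolicDist (pseudohyperbolicDist_lt_one hz ha) h hη

/-- For two factors the cross-multiplied difference is η(1+η)(1-b)(1-P)(1-bP) ≥ 0. The bound η ≤ ∏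
forces every factor to be at least η, so the inductive inequality is multiplied by a nonnegative
number. -/
theorem div_prod_le_prod_div {ι : Type*} (s : Finset ι) (a : ι → ℝ) {η : ℝ} (h0 : 0 ≤ η)
    (h1 : η < 1) (ha0 : ∀ k ∈ s, 0 ≤ a k) (ha1 : ∀ k ∈ s, a k ≤ 1) (h : η ≤ ∏ k ∈ s, a k) :
    (∏ k ∈ s, a k - η) / (1 - η * ∏ k ∈ s, a k) ≤ ∏ k ∈ s, (a k - η) / (1 - η * a k) := by
  classical
  induction s using Finset.induction_on with
  | empty => simp [div_self (sub_ne_zero.2 h1.ne')]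
  | insert i s hi ih =>
    rw [prod_insert hi] at h ⊢
    rw [prod_insert hi]
    have hP1 : ∏ k ∈ s, a k ≤ 1 := prod_le_one (fun k hk => ha0 k (mem_insert_of_mem hk))
      fun k hk => ha1 k (mem_insert_of_mem hk)
    have hP0 : 0 ≤ ∏ k ∈ s, a k := prod_nonneg fun k hk => ha0 k (mem_insert_of_mem hk)
    have hi0 := ha0 i (mem_insert_self i s)
    have hi1 := ha1 i (mem_insert_self i s)
    have ih := ih (fun k hk => ha0 k (mem_insert_of_mem hk))
      (fun k hk => ha1 k (mem_insert_of_mem hk)) (by nlinarith)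
    set b := a i
    set P := ∏ k ∈ s, a k
    have hb : 0 < 1 - η * b := by nlinarith
    have hP : 0 < 1 - η * P := by nlinarith
    have hbP1 : b * P ≤ 1 := mul_le_one₀ hi1 hP0 hP1
    have hbP : 0 < 1 - η * (b * P) := by nlinarith
    calc (b * P - η) / (1 - η * (b * P))
        ≤ (b - η) / (1 - η * b) * ((P - η) / (1 - η * P)) := by
          rw [div_mul_div_comm, div_le_div_iff₀ hbP (mul_pos hb hP), ← sub_nonneg]
          have : (b - η) * (P - η) * (1 - η * (b * P)) -
              (b * P - η) * ((1 - η * b) * (1 - η * P)) =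
              η * (1 + η) * ((1 - b * P) * ((1 - b) * (1 - P))) := by ring
          rw [this]
          have h2 : 0 ≤ 1 - b := by linarith
          have h3 : 0 ≤ 1 - P := by linarith
          have h4 : 0 ≤ 1 - b * P := by linarith
          positivity
      _ ≤ _ := mul_le_mul_of_nonneg_left ih (div_nonneg (by nlinarith) hb.le)

/-- The constant 2η/(1+η²) is the point where x ↦ (x-η)/(1-ηx) takes the value η. -/
theorem le_prod_pseudohyperbolicDist {ι : Type*} (s : Finset ι) {z : ℂ} {w a : ι → ℂ} {η : ℝ}
    (h0 : 0 ≤ η) (h1 : η < 1) (hz : ‖z‖ < 1) (hw : ∀ k, ‖w k‖ < 1) (ha : ∀ k, ‖a k‖ < 1)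
    (h : ∀ k, pseudohyperbolicDist (w k) (a k) ≤ η)
    (hs : 2 * η / (1 + η ^ 2) ≤ ∏ k ∈ s, pseudohyperbolicDist z (a k)) :
    η ≤ ∏ k ∈ s, pseudohyperbolicDist z (w k) := by
  have hd : η ≤ 2 * η / (1 + η ^ 2) := by
    rw [le_div_iff₀ (by positivity)]; nlinarith
  have hP1 : ∏ k ∈ s, pseudohyperbolicDist z (a k) ≤ 1 :=
    prod_le_one (fun _ _ => pseudohyperbolicDist_nonneg _ _)
      fun k _ => (pseudohyperbolicDist_lt_one hz (ha k)).le
  have key := div_prod_le_prod_div s (fun k => pseudohyperbolicDist z (a k)) h0 h1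
    (fun _ _ => pseudohyperbolicDist_nonneg _ _)
    (fun k _ => (pseudohyperbolicDist_lt_one hz (ha k)).le) (hd.trans hs)
  refine le_trans ?_ (key.trans (prod_le_prod ?_ ?_))
  · rw [le_div_iff₀ (by nlinarith)]
    rw [div_le_iff₀ (by positivity)] at hs
    linarith
  · intro k hk
    have h2 : ∏ k ∈ s, pseudohyperbolicDist z (a k) ≤ pseudohyperbolicDist z (a k) := by
      classical
      rw [← mul_prod_erase s _ hk]
      exact mul_le_of_le_one_right (pseudohyperbolicDist_nonneg _ _)
        (prod_le_one (fun _ _ => pseudohyperbolicDist_nonneg _ _)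
          fun k _ => (pseudohyperbolicDist_lt_one hz (ha k)).le)
    have h3 := pseudohyperbolicDist_lt_one hz (ha k)
    exact div_nonneg (by linarith) (by nlinarith [pseudohyperbolicDist_nonneg z (a k)])
  · exact fun k _ => div_le_pseudohyperbolicDist_of_le hz (hw k) (ha k) h1 (h k)

/-! ### Infinitesimal uniqueness -/

open Polynomial in
/-- Infinitesimal uniqueness: if zeros `ζ` of a finite Blaschke product move with velocity `v` such
that its values at the points `z` are stationary, then `v = 0`. -/
theorem velocity_eq_zero {ι : Type*} [Fintype ι] [DecidableEq ι] {z ζ v : ι → ℂ}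
    (hz : ∀ j, ‖z j‖ < 1) (hzi : Function.Injective z)
    (hζ : ∀ j, ‖ζ j‖ < 1) (hζi : Function.Injective ζ)
    (h : ∀ j, (∑ k, (∏ l ∈ univ.erase k, (z j - ζ l)) * v k) *
        ∏ k, (1 - (starRingEnd ℂ) (ζ k) * z j) =
      (∏ k, (z j - ζ k)) * ∑ k, (∏ l ∈ univ.erase k, (1 - (starRingEnd ℂ) (ζ l) * z j)) *
        ((starRingEnd ℂ) (v k) * z j)) :
    v = 0 := by
  -- Primes mark reflected polynomials, not derivatives: the Blaschke product is p/p'. Along `v`,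
  -- the variations of p and p' are -q and -q', so `h` says that q p' - p q' vanishes at every `z
  -- j`.
  set p : ℂ[X] := ∏ k, (X - C (ζ k)) with hp
  set q : ℂ[X] := ∑ k, (∏ l ∈ univ.erase k, (X - C (ζ l))) * C (v k) with hq
  set p' : ℂ[X] := ∏ k, (1 - C ((starRingEnd ℂ) (ζ k)) * X) with hp'
  set q' : ℂ[X] := ∑ k, (∏ l ∈ univ.erase k, (1 - C ((starRingEnd ℂ) (ζ l)) * X)) *
    (C ((starRingEnd ℂ) (v k)) * X) with hq'
  set P : ℂ[X] := ∏ k, (X - C (z k)) with hP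
  set P' : ℂ[X] := ∏ k, (1 - C ((starRingEnd ℂ) (z k)) * X) with hP'
  have ep (w : ℂ) : p.eval w = ∏ k, (w - ζ k) := by simp [hp, eval_prod]
  have eq (w : ℂ) : q.eval w = ∑ k, (∏ l ∈ univ.erase k, (w - ζ l)) * v k := by
    simp [hq, eval_prod, eval_finsetSum]
  have ep' (w : ℂ) : p'.eval w = ∏ k, (1 - (starRingEnd ℂ) (ζ k) * w) := by
    simp [hp', eval_prod]
  have eq' (w : ℂ) : q'.eval w = ∑ k, (∏ l ∈ univ.erase k, (1 - (starRingEnd ℂ) (ζ l) * w)) *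
      ((starRingEnd ℂ) (v k) * w) := by
    simp [hq', eval_prod, eval_finsetSum]
  have eP (w : ℂ) : P.eval w = ∏ k, (w - z k) := by simp [hP, eval_prod]
  have eP' (w : ℂ) : P'.eval w = ∏ k, (1 - (starRingEnd ℂ) (z k) * w) := by
    simp [hP', eval_prod]
  have hdvd : P ∣ q * p' - p * q' := by
    refine Finset.prod_dvd_of_coprime ?_ ?_
    · exact fun i _ j _ hij => pairwise_coprime_X_sub_C hzi hij
    · intro j _
      rw [dvd_iff_isRoot, IsRoot, eval_sub, eval_mul, eval_mul, eq, ep', ep, eq', h j, sub_self]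
  obtain ⟨G, hG⟩ := hdvd
  have hp'0 (w : ℂ) (hw : ‖w‖ ≤ 1) : p'.eval w ≠ 0 := by
    rw [ep']; exact prod_ne_zero_iff.2 fun k _ => one_sub_conj_mul_ne_zero hw (hζ k)
  have hP'0 (w : ℂ) (hw : ‖w‖ ≤ 1) : P'.eval w ≠ 0 := by
    rw [eP']; exact prod_ne_zero_iff.2 fun k _ => one_sub_conj_mul_ne_zero hw (hz k)
  -- On the unit circle reflection becomes conjugation, and Re F is a nonnegative multiple of (Im (q
  -- conj p))². Since F(0) = 0, the maximum principle for exp(-F) forces Re F = 0 there, which kills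
  -- q p' - p q' on the circle.
  set F : ℂ → ℂ := fun w => q'.eval w / p'.eval w * (G.eval w / P'.eval w) with hF
  have hF0 : F 0 = 0 := by simp [hF, eq']
  have hFd : DifferentiableOn ℂ F (Metric.closedBall 0 1) := by
    intro w hw
    have hw : ‖w‖ ≤ 1 := by simpa using hw
    exact ((q'.differentiableAt.div p'.differentiableAt (hp'0 w hw)).mul
      (G.differentiableAt.div P'.differentiableAt (hP'0 w hw))).differentiableWithinAt
  have hsphere (w : ℂ) (hw : ‖w‖ = 1) : (F w).re =
      2 * (q.eval w * (starRingEnd ℂ) (p.eval w)).im ^ 2 /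
        (Complex.normSq (p.eval w) * Complex.normSq (P.eval w)) ∧
      p.eval w ≠ 0 ∧ P.eval w ≠ 0 ∧ (q * p' - p * q').eval w = w ^ Fintype.card ι *
        (q.eval w * (starRingEnd ℂ) (p.eval w) -
          (starRingEnd ℂ) (q.eval w * (starRingEnd ℂ) (p.eval w))) := by
    have hc : w * (starRingEnd ℂ) w = 1 := by
      rw [Complex.mul_conj, Complex.normSq_eq_norm_sq, hw]; simp
    have hf (a : ℂ) : 1 - (starRingEnd ℂ) a * w = w * (starRingEnd ℂ) (w - a) := by
      rw [map_sub, mul_sub, hc, mul_comm w]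
    have f1 : p'.eval w = w ^ Fintype.card ι * (starRingEnd ℂ) (p.eval w) := by
      rw [ep', ep, map_prod]; simp_rw [hf]
      rw [prod_mul_distrib, prod_const, card_univ]
    have f2 : P'.eval w = w ^ Fintype.card ι * (starRingEnd ℂ) (P.eval w) := by
      rw [eP', eP, map_prod]; simp_rw [hf]
      rw [prod_mul_distrib, prod_const, card_univ]
    have f3 : q'.eval w = w ^ Fintype.card ι * (starRingEnd ℂ) (q.eval w) := by
      rw [eq', eq, map_sum, mul_sum]
      refine sum_congr rfl fun k _ => ?_
      simp_rw [hf]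
      rw [prod_mul_distrib, prod_const, ← card_univ, ← card_erase_add_one (mem_univ k), map_mul,
        map_prod, pow_succ]
      ring
    have hw0 : w ^ Fintype.card ι ≠ 0 := pow_ne_zero _ (by rintro rfl; simp at hw)
    have hp0 : (starRingEnd ℂ) (p.eval w) ≠ 0 := by
      intro h0; exact hp'0 w hw.le (by rw [f1, h0, mul_zero])
    have hP0 : (starRingEnd ℂ) (P.eval w) ≠ 0 := by
      intro h0; exact hP'0 w hw.le (by rw [f2, h0, mul_zero])
    have hp1 : p.eval w ≠ 0 := by simpa using hp0
    have hP1 : P.eval w ≠ 0 := by simpa using hP0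
    have hH : (q * p' - p * q').eval w = w ^ Fintype.card ι *
        (q.eval w * (starRingEnd ℂ) (p.eval w) -
          (starRingEnd ℂ) (q.eval w * (starRingEnd ℂ) (p.eval w))) := by
      rw [eval_sub, eval_mul, eval_mul, f1, f3, map_mul, Complex.conj_conj]; ring
    refine ⟨?_, hp1, hP1, hH⟩
    have hGe : G.eval w = (q * p' - p * q').eval w / P.eval w := by
      rw [hG, eval_mul, mul_div_cancel_left₀ _ hP1]
    set s := q.eval w * (starRingEnd ℂ) (p.eval w) with hs
    have hFe : F w = (starRingEnd ℂ) s * (s - (starRingEnd ℂ) s) /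
        ((Complex.normSq (p.eval w) * Complex.normSq (P.eval w) : ℝ) : ℂ) := by
      have e1 : F w = (starRingEnd ℂ) (q.eval w) * (s - (starRingEnd ℂ) s) /
          ((starRingEnd ℂ) (p.eval w) * (P.eval w * (starRingEnd ℂ) (P.eval w))) := by
        simp only [hF]
        rw [hGe, hH, f1, f2, f3]
        field_simp
      have e2 : (starRingEnd ℂ) s = (starRingEnd ℂ) (q.eval w) * p.eval w := by
        rw [hs, map_mul, Complex.conj_conj]
      rw [e1, Complex.ofReal_mul, ← Complex.mul_conj, ← Complex.mul_conj]
      nth_rewrite 2 [e2]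
      field_simp
    rw [hFe, Complex.div_ofReal_re]
    congr 1
    simp
    ring
  have hre (w : ℂ) (hw : ‖w‖ = 1) : 0 ≤ (F w).re := by
    rw [(hsphere w hw).1]
    exact div_nonneg (by positivity) (mul_nonneg (Complex.normSq_nonneg _) (Complex.normSq_nonneg _))
  have hE : DiffContOnCl ℂ (fun w => Complex.exp (-F w)) (Metric.ball 0 1) :=
    hFd.neg.cexp.diffContOnCl_ball subset_rfl
  have hle (w : ℂ) (hw : ‖w‖ ≤ 1) : ‖Complex.exp (-F w)‖ ≤ 1 := by
    refine Complex.norm_le_of_forall_mem_frontier_norm_le Metric.isBounded_ball hE ?_ ?_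
    · intro y hy
      rw [frontier_ball _ one_ne_zero] at hy
      have := hre y (by simpa using hy)
      rw [Complex.norm_exp]
      simpa using this
    · rw [closure_ball _ one_ne_zero]; simpa using hw
  have hmax := Complex.norm_eqOn_closedBall_of_isMaxOn hE (z := 0) (r := 1) (by
    intro w hw
    have hw : ‖w‖ < 1 := by simpa using hw
    simpa [hF0] using hle w hw.le)
  have hroot : ∀ w ∈ Metric.sphere (0 : ℂ) 1, (q * p' - p * q').IsRoot w := by
    intro w hw
    have hw1 : ‖w‖ = 1 := by simpa using hw
    have e1 := hmax (Metric.sphere_subset_closedBall hw)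
    obtain ⟨e2, hp0, hP0, e3⟩ := hsphere w hw1
    have e4 : (F w).re = 0 := by simpa [Complex.norm_exp, hF0] using e1
    rw [e4, eq_comm, div_eq_zero_iff] at e2
    have e5 : (q.eval w * (starRingEnd ℂ) (p.eval w)).im = 0 := by
      rcases e2 with e2 | e2
      · simpa using e2
      · simp [hp0, hP0] at e2
    rw [IsRoot, e3, Complex.conj_eq_iff_im.2 e5, sub_self, mul_zero]
  have hinf : (Metric.sphere (0 : ℂ) 1).Infinite := by
    refine (isPreconnected_sphere (by simp [Complex.rank_real_complex]) 0 1).infinite_of_nontrivial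
      ⟨1, by simp, -1, by simp, ?_⟩
    norm_num [Complex.ext_iff]
  have hzero : q * p' - p * q' = 0 := eq_zero_of_infinite_isRoot _ (hinf.mono hroot)
  funext k
  have e1 := congrArg (eval (ζ k)) hzero
  have e2 : p.eval (ζ k) = 0 := by rw [ep]; exact prod_eq_zero (mem_univ k) (sub_self _)
  rw [eval_sub, eval_mul, eval_mul, e2, zero_mul, sub_zero, eval_zero, mul_eq_zero,
    or_iff_left (hp'0 _ (hζ k).le), eq, sum_eq_single k, mul_eq_zero] at e1
  · refine e1.resolve_left (prod_ne_zero_iff.2 fun l hl => sub_ne_zero.2 fun e => ?_)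
    exact (mem_erase.1 hl).1 (hζi e).symm
  · intro l _ hl
    rw [prod_eq_zero (mem_erase.2 ⟨hl.symm, mem_univ k⟩) (sub_self _), zero_mul]
  · exact fun hk => (hk (mem_univ k)).elim

/-! ### Interpolation by moving the zeros -/

/-- The values at the points `z` of the finite Blaschke product with zeros `ζ`. -/
noncomputable def blaschkeValues {ι : Type*} [Fintype ι] (z ζ : ι → ℂ) : ι → ℂ :=
  fun j => ∏ k, blaschkeFactor (ζ k) (z j)

theorem contDiffAt_blaschkeValues {ι : Type*} [Fintype ι] {z ζ : ι → ℂ}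
    (hz : ∀ j, ‖z j‖ < 1) (hζ : ∀ j, ‖ζ j‖ ≤ 1) : ContDiffAt ℝ 1 (blaschkeValues z) ζ := by
  refine contDiffAt_pi.2 fun j => contDiffAt_prod
    (f := fun k (ξ : ι → ℂ) => blaschkeFactor (ξ k) (z j)) fun k _ => ?_
  have h1 : ContDiffAt ℝ 1 (fun ξ : ι → ℂ => ξ k) ζ := contDiffAt_pi.1 contDiffAt_id k
  have h2 : ContDiffAt ℝ 1 (fun ξ : ι → ℂ => (starRingEnd ℂ) (ξ k)) ζ :=
    Complex.conjCLE.contDiff.contDiffAt.comp ζ h1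
  have h3 : ContDiffAt ℝ 1 (fun ξ : ι → ℂ => 1 - (starRingEnd ℂ) (ξ k) * z j) ζ :=
    contDiffAt_const.sub (h2.mul contDiffAt_const)
  have h4 : ContDiffAt ℝ 1 (fun ξ : ι → ℂ => z j - ξ k) ζ := contDiffAt_const.sub h1
  simp only [blaschkeFactor, div_eq_mul_inv]
  refine h4.mul (h3.inv ?_)
  have := one_sub_conj_mul_ne_zero (hζ k) (hz j)
  intro h5
  apply this
  rw [← (starRingEnd ℂ).injective.eq_iff]
  simpa [mul_comm] using h5

/-- The dependence on the zeros is only real differentiable, because of the conjugates. Source and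
target have equal finite dimension, so an injective derivative is surjective and the map is locally
open. -/
theorem map_nhds_blaschkeValues {ι : Type*} [Fintype ι] {z ζ : ι → ℂ}
    (hz : ∀ j, ‖z j‖ < 1) (hzi : Function.Injective z)
    (hζ : ∀ j, ‖ζ j‖ < 1) (hζi : Function.Injective ζ) :
    Filter.map (blaschkeValues z) (nhds ζ) = nhds (blaschkeValues z ζ) := by
  classical
  have hs := (contDiffAt_blaschkeValues hz fun j => (hζ j).le).hasStrictFDerivAt one_ne_zero
  refine hs.map_nhds_eq_of_surj ?_
  rw [LinearMap.range_eq_top]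
  refine LinearMap.injective_iff_surjective.1 ((injective_iff_map_eq_zero _).2 fun v hv => ?_)
  refine velocity_eq_zero hz hzi hζ hζi fun j => ?_
  have hγ : HasDerivAt (fun s : ℝ => ζ + s • v) v 0 := by
    simpa using ((hasDerivAt_id (0 : ℝ)).smul_const v).const_add ζ
  have hs' : HasFDerivAt (blaschkeValues z) (fderiv ℝ (blaschkeValues z) ζ) (ζ + (0 : ℝ) • v) := by
    simpa using hs.hasFDerivAt
  have h0 := hasDerivAt_pi.1 (hs'.comp_hasDerivAt 0 hγ) j
  have hN : HasDerivAt (fun s : ℝ => ∏ k, (z j - (ζ k + s • v k)))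
      (∑ k, (∏ l ∈ univ.erase k, (z j - (ζ l + (0 : ℝ) • v l))) • (-v k)) 0 :=
    HasDerivAt.fun_finsetProd fun k _ => by
      simpa using (((hasDerivAt_id (0 : ℝ)).smul_const (v k)).const_add (ζ k)).const_sub (z j)
  have hD : HasDerivAt (fun s : ℝ => ∏ k, (1 - (starRingEnd ℂ) (ζ k + s • v k) * z j))
      (∑ k, (∏ l ∈ univ.erase k, (1 - (starRingEnd ℂ) (ζ l + (0 : ℝ) • v l) * z j)) •
        (-((starRingEnd ℂ) (v k) * z j))) 0 :=
    HasDerivAt.fun_finsetProd fun k _ => by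
      simpa using ((((hasDerivAt_id (0 : ℝ)).smul_const ((starRingEnd ℂ) (v k))).const_add
        ((starRingEnd ℂ) (ζ k))).mul_const (z j)).const_sub 1
  have hD0 : ∏ k, (1 - (starRingEnd ℂ) (ζ k) * z j) ≠ 0 :=
    prod_ne_zero_iff.2 fun k _ => one_sub_conj_mul_ne_zero (hz j).le (hζ k)
  have hq := hN.fun_div hD (by simpa using hD0)
  have e0 : (fun s : ℝ => (blaschkeValues z ∘ fun s : ℝ => ζ + s • v) s j) = fun s : ℝ =>
      (∏ k, (z j - (ζ k + s • v k))) / ∏ k, (1 - (starRingEnd ℂ) (ζ k + s • v k) * z j) := by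
    funext s
    rw [← prod_div_distrib]
    rfl
  have e1 := h0.unique (e0 ▸ hq)
  have hv : fderiv ℝ (blaschkeValues z) ζ v = 0 := hv
  rw [hv, Pi.zero_apply, eq_comm, div_eq_zero_iff] at e1
  have e2 := e1.resolve_right (by simpa using hD0)
  simp only [zero_smul, add_zero, smul_eq_mul, mul_neg, sum_neg_distrib, neg_mul,
    sub_neg_eq_add] at e2
  linear_combination -e2

theorem exists_blaschkeValues_eq {ι : Type*} [Fintype ι] [DecidableEq ι] {z : ι → ℂ} {η : ℝ}
    (h0 : 0 < η) (h1 : η < 1) (hz : ∀ j, ‖z j‖ < 1) (hzi : Function.Injective z)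
    (hsep : ∀ j, 2 * η / (1 + η ^ 2) ≤ ∏ k ∈ univ.erase j, pseudohyperbolicDist (z j) (z k))
    {u : ι → ℂ} (hu : ∀ j, ‖u j‖ < η ^ 2) :
    ∃ ζ : ι → ℂ, (∀ k, ‖ζ k‖ < 1) ∧ blaschkeValues z ζ = u := by
  set V : Set (ι → ℂ) := {ζ | ∀ k, ‖ζ k‖ < 1 ∧ ‖z k - ζ k‖ < η * ‖1 - (starRingEnd ℂ) (z k) * ζ k‖}
    with hV
  set W : Set (ι → ℂ) := {ζ | ∀ k, ‖ζ k‖ ≤ 1 ∧ ‖z k - ζ k‖ ≤ η * ‖1 - (starRingEnd ℂ) (z k) * ζ k‖}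
    with hW
  have hne {ζ : ι → ℂ} (k) (h : ‖ζ k‖ ≤ 1) : 0 < ‖1 - (starRingEnd ℂ) (z k) * ζ k‖ :=
    norm_pos_iff.2 (one_sub_conj_mul_ne_zero h (hz k))
  -- If `‖ζ k‖ = 1`, its pseudohyperbolic distance to `z k` would be 1 > η. Thus `W` can be closed
  -- in ℂ, hence compact, yet lie in the open polydisk.
  have hW1 {ζ} (hζ : ζ ∈ W) (k) : ‖ζ k‖ < 1 := by
    refine lt_of_le_of_ne (hζ k).1 fun h => ?_
    have h2 := norm_one_sub_conj_mul_sq (ζ k) (z k)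
    rw [h, norm_sub_rev (ζ k)] at h2
    have h3 := hne k (hζ k).1
    have h4 := (hζ k).2
    have h5 : ‖1 - (starRingEnd ℂ) (z k) * ζ k‖ = ‖z k - ζ k‖ := by
      rw [← sq_eq_sq₀ (norm_nonneg _) (norm_nonneg _), h2]; ring
    rw [← h5] at h4
    nlinarith
  have hρ {ζ : ι → ℂ} (k) : pseudohyperbolicDist (ζ k) (z k) =
      ‖z k - ζ k‖ / ‖1 - (starRingEnd ℂ) (z k) * ζ k‖ := by
    rw [pseudohyperbolicDist, norm_div, norm_sub_rev]
  have hWρ {ζ} (hζ : ζ ∈ W) (k) : pseudohyperbolicDist (ζ k) (z k) ≤ η := by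
    rw [hρ, div_le_iff₀ (hne k (hζ k).1)]; exact (hζ k).2
  have hVW : V ⊆ W := fun ζ hζ k => ⟨(hζ k).1.le, (hζ k).2.le⟩
  have hprod {ζ} (hζ : ζ ∈ W) (j) :
      η ≤ ∏ k ∈ univ.erase j, pseudohyperbolicDist (z j) (ζ k) :=
    le_prod_pseudohyperbolicDist _ h0.le h1 (hz j) (hW1 hζ) hz (hWρ hζ) (hsep j)
  -- If ζ_j = ζ_k, the factor ρ(z_j, ζ_k) = ρ(z_j, ζ_j) < η would push the product in `hprod` below
  -- η.
  have hVi {ζ} (hζ : ζ ∈ V) : Function.Injective ζ := by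
    intro j k hjk
    by_contra hne'
    have h3 := hprod (hVW hζ) j
    have hk : k ∈ univ.erase j := mem_erase.2 ⟨fun h => hne' h.symm, mem_univ k⟩
    rw [← mul_prod_erase _ _ hk] at h3
    have h4 : pseudohyperbolicDist (z j) (ζ k) < η := by
      rw [← hjk, pseudohyperbolicDist_comm, hρ, div_lt_iff₀ (hne j (hζ j).1.le)]
      exact (hζ j).2
    have h5 : ∏ l ∈ (univ.erase j).erase k, pseudohyperbolicDist (z j) (ζ l) ≤ 1 :=
      prod_le_one (fun _ _ => pseudohyperbolicDist_nonneg _ _)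
        fun l _ => (pseudohyperbolicDist_lt_one (hz j) (hW1 (hVW hζ) l)).le
    exact absurd (h3.trans (mul_le_of_le_one_right (pseudohyperbolicDist_nonneg _ _) h5))
      (not_le.2 h4)
  have hVo : IsOpen V := by
    have : V = ⋂ k, {ζ : ι → ℂ | ‖ζ k‖ < 1 ∧
        ‖z k - ζ k‖ < η * ‖1 - (starRingEnd ℂ) (z k) * ζ k‖} := by ext; simp [hV]
    rw [this]
    refine isOpen_iInter_of_finite fun k => ?_
    rw [Set.ofPred_and]
    exact (isOpen_lt (by fun_prop) (by fun_prop)).inter (isOpen_lt (by fun_prop) (by fun_prop))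
  have hWc : IsCompact W := by
    refine Metric.isCompact_of_isClosed_isBounded ?_ ?_
    · have : W = ⋂ k, {ζ : ι → ℂ | ‖ζ k‖ ≤ 1 ∧
          ‖z k - ζ k‖ ≤ η * ‖1 - (starRingEnd ℂ) (z k) * ζ k‖} := by ext; simp [hW]
      rw [this]
      refine isClosed_iInter fun k => ?_
      rw [Set.ofPred_and]
      exact (isClosed_le (by fun_prop) (by fun_prop)).inter
        (isClosed_le (by fun_prop) (by fun_prop))
    · refine (Metric.isBounded_closedBall (x := (0 : ι → ℂ)) (r := 1)).subset fun ζ hζ => ?_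
      rw [mem_closedBall_zero_iff, pi_norm_le_iff_of_nonneg zero_le_one]
      exact fun k => (hζ k).1
  have hcont : ContinuousOn (blaschkeValues z) W := fun ζ hζ =>
    (contDiffAt_blaschkeValues hz fun k => (hζ k).1).continuousAt.continuousWithinAt
  have hopen : IsOpen (blaschkeValues z '' V) := by
    rw [isOpen_iff_mem_nhds]
    rintro _ ⟨ζ, hζ, rfl⟩
    rw [← map_nhds_blaschkeValues hz hzi (fun k => (hζ k).1) (hVi hζ)]
    exact Filter.image_mem_map (hVo.mem_nhds hζ)
  have hclosed : IsClosed (blaschkeValues z '' W) := (hWc.image_of_continuousOn hcont).isClosed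
  -- At a boundary point some ρ(z_k, ζ_k) is at least η, and the other factors contribute at least η
  -- by `hprod`, so the k-th value has modulus at least η².
  have hWV {ζ} (hζ : ζ ∈ W) (h : ∀ j, ‖blaschkeValues z ζ j‖ < η ^ 2) : ζ ∈ V := by
    refine fun k => ⟨hW1 hζ k, lt_of_not_ge fun h3 => ?_⟩
    have h4 : η ≤ pseudohyperbolicDist (z k) (ζ k) := by
      rw [pseudohyperbolicDist_comm, hρ, le_div_iff₀ (hne k (hζ k).1)]; exact h3
    have h5 : ‖blaschkeValues z ζ k‖ = pseudohyperbolicDist (z k) (ζ k) *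
        ∏ l ∈ univ.erase k, pseudohyperbolicDist (z k) (ζ l) := by
      rw [mul_prod_erase _ (fun l => pseudohyperbolicDist (z k) (ζ l)) (mem_univ k),
        blaschkeValues, norm_prod]
      rfl
    have h6 := h k
    rw [h5] at h6
    nlinarith [mul_le_mul h4 (hprod hζ k) h0.le (h0.le.trans h4)]
  set Q : Set (ι → ℂ) := Metric.ball 0 (η ^ 2) with hQ
  have hQm (w : ι → ℂ) : w ∈ Q ↔ ∀ j, ‖w j‖ < η ^ 2 := by
    rw [hQ, mem_ball_zero_iff, pi_norm_lt_iff (by positivity)]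
  have hsub : Q ⊆ blaschkeValues z '' V := by
    -- By `hWV` the connected ball `Q` is covered by two disjoint open sets, the image of `V` and
    -- the complement of the image of `W`; it meets the first at 0, the value at ζ = z.
    refine IsPreconnected.subset_left_of_subset_union hopen hclosed.isOpen_compl
      (Set.disjoint_compl_right_iff_subset.2 (Set.image_mono hVW)) ?_ ?_
      (convex_ball 0 _).isPreconnected
    · intro w hw
      by_cases h : w ∈ blaschkeValues z '' W
      · obtain ⟨ζ, hζ, rfl⟩ := h
        exact Or.inl ⟨ζ, hWV hζ ((hQm _).1 hw), rfl⟩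
      · exact Or.inr h
    · refine ⟨0, by simp only [hQm]; intro j; simpa using by positivity, z, fun k => ⟨hz k, ?_⟩, ?_⟩
      · simpa using mul_pos h0 (hne (ζ := z) k (hz k).le)
      · funext j
        exact prod_eq_zero (mem_univ j) (by simp [blaschkeFactor])
  obtain ⟨ζ, hζ, h⟩ := hsub ((hQm u).2 hu)
  exact ⟨ζ, fun k => (hζ k).1, h⟩

/-! ### Blaschke products of a contraction -/

/-- The cross terms cancel, and the difference of the squared norms is (1-|a|²)(‖x‖²-‖y‖²). -/
theorem norm_sub_smul_le_of_contraction {E : Type*} [NormedAddCommGroup E] [InnerProductSpace ℂ E]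
    {a : ℂ} (ha : ‖a‖ ≤ 1) {x y : E} (h : ‖y‖ ≤ ‖x‖) :
    ‖y - a • x‖ ≤ ‖x - (starRingEnd ℂ) a • y‖ := by
  refine le_of_sq_le_sq ?_ (norm_nonneg _)
  have e : RCLike.re (inner ℂ x ((starRingEnd ℂ) a • y)) = RCLike.re (inner ℂ y (a • x)) := by
    rw [inner_smul_right, inner_smul_right, ← inner_conj_symm x y, ← map_mul, RCLike.conj_re]
  rw [norm_sub_sq (𝕜 := ℂ), norm_sub_sq (𝕜 := ℂ), e, norm_smul, norm_smul, RCLike.norm_conj]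
  have h1 : ‖a‖ ^ 2 ≤ 1 := by nlinarith [norm_nonneg a]
  have h2 : ‖y‖ ^ 2 ≤ ‖x‖ ^ 2 := by nlinarith [norm_nonneg y]
  nlinarith [mul_nonneg (sub_nonneg.2 h1) (sub_nonneg.2 h2)]

/-- Here M is the Blaschke factor of A. Writing each vector as (1 - conj a A)x turns the bound into
the preceding inequality for x and Ax. -/
theorem Matrix.norm_le_one_of_mul_eq {n : ℕ} {A M V : Matrix (Fin n) (Fin n) ℂ} {a : ℂ}
    (hA : ‖A‖ ≤ 1) (ha : ‖a‖ ≤ 1) (hM : M * (1 - (starRingEnd ℂ) a • A) = A - a • 1)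
    (hV : (1 - (starRingEnd ℂ) a • A) * V = 1) : ‖M‖ ≤ 1 := by
  rw [← Matrix.l2_opNorm_toEuclideanCLM]
  refine ContinuousLinearMap.opNorm_le_bound _ zero_le_one fun y => ?_
  set T := Matrix.toEuclideanCLM (n := Fin n) (𝕜 := ℂ) A with hT
  set x := Matrix.toEuclideanCLM (n := Fin n) (𝕜 := ℂ) V y with hx
  have hy : x - (starRingEnd ℂ) a • T x = y := by
    have := congrArg (fun N => Matrix.toEuclideanCLM (n := Fin n) (𝕜 := ℂ) N y) hV
    simp only [map_mul, map_sub, map_smul, map_one] at this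
    exact this
  have hMy : Matrix.toEuclideanCLM (n := Fin n) (𝕜 := ℂ) M y = T x - a • x := by
    have := congrArg (fun N => Matrix.toEuclideanCLM (n := Fin n) (𝕜 := ℂ) N x) hM
    simp only [map_mul, map_sub, map_smul, map_one] at this
    have e : Matrix.toEuclideanCLM (n := Fin n) (𝕜 := ℂ) M (x - (starRingEnd ℂ) a • T x) =
      T x - a • x := this
    rwa [hy] at e
  have hTx : ‖T x‖ ≤ ‖x‖ := by
    have := T.le_opNorm x
    rw [hT, Matrix.l2_opNorm_toEuclideanCLM] at this
    nlinarith [norm_nonneg x]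
  rw [hMy, one_mul]
  refine le_of_le_of_eq ?_ (congrArg norm hy)
  exact norm_sub_smul_le_of_contraction ha hTx

theorem conj_diagonal_mul {n : ℕ} {X : Matrix (Fin n) (Fin n) ℂ} (hX : IsUnit X.det)
    (d e : Fin n → ℂ) : X * Matrix.diagonal d * X⁻¹ * (X * Matrix.diagonal e * X⁻¹) =
      X * Matrix.diagonal (d * e) * X⁻¹ := by
  rw [show d * e = fun i => d i * e i from rfl, ← Matrix.diagonal_mul_diagonal]
  simp only [Matrix.mul_assoc]
  rw [← Matrix.mul_assoc X⁻¹ X, Matrix.nonsing_inv_mul X hX, Matrix.one_mul]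

theorem norm_conj_diagonal_blaschkeFactor_le {n : ℕ} {A X : Matrix (Fin n) (Fin n) ℂ}
    {z : Fin n → ℂ} (hA : ‖A‖ ≤ 1) (hX : IsDiagonalization A X z) (hz : ∀ j, ‖z j‖ < 1) {a : ℂ}
    (ha : ‖a‖ < 1) : ‖X * Matrix.diagonal (fun j => blaschkeFactor a (z j)) * X⁻¹‖ ≤ 1 := by
  obtain ⟨hXu, hAX⟩ := hX
  have hXd := (Matrix.isUnit_iff_isUnit_det X).1 hXu
  have h1 : (1 : Matrix (Fin n) (Fin n) ℂ) = X * Matrix.diagonal (fun _ => 1) * X⁻¹ := by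
    rw [Matrix.diagonal_one, Matrix.mul_one, Matrix.mul_nonsing_inv X hXd]
  have h2 (b : ℂ) : b • A = X * Matrix.diagonal (fun j => b * z j) * X⁻¹ := by
    rw [hAX, ← Matrix.smul_mul, ← Matrix.mul_smul, ← Matrix.diagonal_smul]; rfl
  have h3 : 1 - (starRingEnd ℂ) a • A =
      X * Matrix.diagonal (fun j => 1 - (starRingEnd ℂ) a * z j) * X⁻¹ := by
    rw [h2, h1, ← Matrix.sub_mul, ← Matrix.mul_sub, Matrix.diagonal_sub]
  have h4 : A - a • 1 = X * Matrix.diagonal (fun j => z j - a) * X⁻¹ := by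
    rw [h1, ← Matrix.smul_mul, ← Matrix.mul_smul, ← Matrix.diagonal_smul, hAX, ← Matrix.sub_mul,
      ← Matrix.mul_sub, Matrix.diagonal_sub]
    simp
  have hne (j) := one_sub_conj_mul_ne_zero (hz j).le ha
  refine Matrix.norm_le_one_of_mul_eq
    (V := X * Matrix.diagonal (fun j => (1 - (starRingEnd ℂ) a * z j)⁻¹) * X⁻¹) hA ha.le ?_ ?_
  · rw [h3, h4, conj_diagonal_mul hXd]
    congr 3
    funext j
    exact div_mul_cancel₀ _ (hne j)
  · rw [h3, conj_diagonal_mul hXd, h1]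
    congr 3
    funext j
    exact mul_inv_cancel₀ (hne j)

theorem norm_conj_diagonal_blaschkeValues_le {n : ℕ} {A X : Matrix (Fin n) (Fin n) ℂ}
    {z : Fin n → ℂ} (hA : ‖A‖ ≤ 1) (hX : IsDiagonalization A X z) (hz : ∀ j, ‖z j‖ < 1)
    {ζ : Fin n → ℂ} (hζ : ∀ k, ‖ζ k‖ < 1) :
    ‖X * Matrix.diagonal (blaschkeValues z ζ) * X⁻¹‖ ≤ 1 := by
  have hXd := (Matrix.isUnit_iff_isUnit_det X).1 hX.1
  suffices h : ∀ s : Finset (Fin n),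
      ‖X * Matrix.diagonal (fun j => ∏ k ∈ s, blaschkeFactor (ζ k) (z j)) * X⁻¹‖ ≤ 1 from h univ
  intro s
  induction s using Finset.induction_on with
  | empty =>
    simp only [prod_empty]
    rw [Matrix.diagonal_one, Matrix.mul_one, Matrix.mul_nonsing_inv X hXd,
      ← Matrix.l2_opNorm_toEuclideanCLM, map_one]
    exact ContinuousLinearMap.norm_id_le
  | insert i s hi ih =>
    simp only [prod_insert hi]
    have := conj_diagonal_mul hXd (fun j => blaschkeFactor (ζ i) (z j))
      fun j => ∏ k ∈ s, blaschkeFactor (ζ k) (z j)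
    rw [Pi.mul_def] at this
    rw [← this]
    exact (norm_mul_le _ _).trans (mul_le_one₀
      (norm_conj_diagonal_blaschkeFactor_le hA hX hz (hζ i)) (norm_nonneg _) ih)

/-! ### Conclusion -/

theorem mainTheorem2 (n : ℕ) (A : Matrix (Fin n) (Fin n) ℂ) (hA : ‖A‖ ≤ 1)
    (z : Fin n → ℂ) (hz : Function.Injective z) (hspec : spectrum ℂ A = Set.range z)
    (hdisk : ∀ j, z j ∈ Metric.ball (0 : ℂ) 1)
    (hsep : 2 * Real.sqrt 2 / 3 ≤ separationConstant z)
    (f : ℂ → ℂ) (hf : MemHInfty f) :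
    ‖matrixFun f A‖ ≤ 2 * ⨆ j, ‖f (z j)‖ := by
  obtain ⟨X, hX⟩ := exists_isDiagonalization hz hspec
  rw [matrixFun_eq hX]
  have hz1 : ∀ j, ‖z j‖ < 1 := fun j => by simpa using hdisk j
  have hm (j) : ‖f (z j)‖ ≤ ⨆ j, ‖f (z j)‖ :=
    le_ciSup (f := fun j => ‖f (z j)‖) (Set.finite_range _).bddAbove j
  have hm0 : 0 ≤ ⨆ j, ‖f (z j)‖ := Real.iSup_nonneg fun _ => norm_nonneg _
  have h2 : Real.sqrt 2 ^ 2 = 2 := Real.sq_sqrt zero_le_two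
  have h20 : 0 < Real.sqrt 2 := by positivity
  -- Interpolation needs strict bounds on the targets, and s > 0 is needed even when all values of f
  -- vanish.
  refine le_of_forall_gt_imp_ge_of_dense fun s hs => ?_
  have hs0 : 0 < s := lt_of_le_of_lt (by positivity) hs
  have hsep' (j) : 2 * (Real.sqrt 2 / 2) / (1 + (Real.sqrt 2 / 2) ^ 2) ≤
      ∏ k ∈ univ.erase j, pseudohyperbolicDist (z j) (z k) := by
    refine le_trans (le_of_eq ?_) (hsep.trans (ciInf_le (Set.finite_range _).bddBelow j))
    rw [div_pow, h2]; ring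
  have hu' (j) : ‖(s : ℂ)⁻¹ * f (z j)‖ < (Real.sqrt 2 / 2) ^ 2 := by
    rw [norm_mul, norm_inv, Complex.norm_real, Real.norm_of_nonneg hs0.le, div_pow, h2,
      inv_mul_lt_iff₀ hs0]
    linarith [hm j]
  obtain ⟨ζ, hζ, hu⟩ := exists_blaschkeValues_eq (by positivity) (by nlinarith) hz1 hz hsep' hu'
  have h4 : X * Matrix.diagonal (f ∘ z) * X⁻¹ =
      (s : ℂ) • (X * Matrix.diagonal (blaschkeValues z ζ) * X⁻¹) := by
    rw [hu, ← Matrix.smul_mul, ← Matrix.mul_smul, ← Matrix.diagonal_smul]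
    congr 3
    funext j
    exact (mul_inv_cancel_left₀ (Complex.ofReal_ne_zero.2 hs0.ne') _).symm
  rw [h4, norm_smul, Complex.norm_real, Real.norm_of_nonneg hs0.le]
  exact mul_le_of_le_one_right hs0.le (norm_conj_diagonal_blaschkeValues_le hA hX hz1 hζ)
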